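/- Let $\mathbf{C}$ be the space of continuous functions $[0,1]\to[-1,1]$ with the topology of uniform convergence. A permutation process of $\mathcal{S}_n$ of length $t_n\ge 1$ is a sequence $\sigma^n=(\sigma^n_t;\,0\le t\le t_n)$ of permutations of $\{1,\dots,n\}$ with $\sigma^n_0=\mathrm{id}$. For $1 \le i \le n$ let $T^n_i\in\mathbf{C}$ be the function with $T^n_i(t/t_n)=\frac{2\sigma^n_t(i)}{n}-1$ for $t=0,1,\dots,t_n$, interpolated linearly between these times; the trajectory process of $\sigma^n$ is the Borel probability measure $X^n=\frac1n\sum_{i=1}^n\delta_{T^n_i}$ on $\mathbf{C}$. A sequence $\sigma^n$, $n = 1, 2, \dots$, of permutation processes of $\mathcal{S}_n$ converges to a $[-1,1]$-valued stochastic process $X=(X(t),\,0\le t\le1)$ with continuous sample paths if $X^n$ converges weakly to the law of $X$, that is, $\frac1n\sum_{i=1}^nF(T^n_i)\to\mathbb{E}[F(X)]$ for every bounded and uniformly continuous $F:\mathbf{C}\to\mathbb{R}$. A permuton process is a $[-1,1]$-valued stochastic process $X = (X(t),\,0\le t\le1)$ with continuous sample paths such that $X(t)\sim\mathrm{Uniform}[-1,1]$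 for every $t\in[0,1]$. Theorem. For each $n$, let $\sigma^n$ be a permutation process of $\mathcal{S}_n$ of length $t_n$, with $t_n\to\infty$ as $n\to\infty$. If $\{\sigma^n\}$ converges to a $[-1,1]$-valued process $X$ with continuous sample paths, then $X$ is a permuton process. Conversely, for every permuton process $X$ there is a sequence of permutation processes $\sigma^n$ of $\mathcal{S}_n$, with lengths $t_n\to\infty$, that converges to $X$. -/

import Mathlib

open MeasureTheory Filter Topology

/-- The space `C([0,1], [-1,1])` with the topology (and uniformity) of uniform convergence. -/
abbrev PathSpace : Type := C(unitInterval, Set.Icc (-1 : ℝ) 1)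

/-- A permutation process of `S_n`: a finite sequence `σ_0 = id, σ_1, …, σ_{t_n}` of permutations
of the `n` particles, of length `t_n ≥ 1`. The element `i` of `Fin n` stands for particle `i + 1`
of `{1, …, n}`. -/
structure PermutationProcess (n : ℕ) where
  /-- the length `t_n` -/
  length : ℕ
  length_pos : 0 < length
  /-- the permutations `σ_t` for `0 ≤ t ≤ t_n` -/
  perm : Fin (length + 1) → Equiv.Perm (Fin n)
  perm_zero : perm 0 = 1

/-- The piecewise linear function on `[0, m]` with value `v k` at the integer `k`, `0 ≤ k ≤ m`,
written in the basis of hat functions `x ↦ max 0 (1 - |x - k|)`. -/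
noncomputable def linearInterp {m : ℕ} (v : Fin (m + 1) → ℝ) (x : ℝ) : ℝ :=
  ∑ k : Fin (m + 1), v k * max 0 (1 - |x - (k : ℕ)|)

/-- Between consecutive integers, `linearInterp v` is the linear interpolation of the values. -/
theorem linearInterp_eq {m : ℕ} (v : Fin (m + 1) → ℝ) (k : Fin m) {x : ℝ}
    (h₀ : ((k : ℕ) : ℝ) ≤ x) (h₁ : x ≤ (k : ℕ) + 1) :
    linearInterp v x =
      ((k : ℕ) + 1 - x) * v k.castSucc + (x - (k : ℕ)) * v k.succ := by
  unfold linearInterp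
  have hne : k.castSucc ≠ k.succ := by
    intro h
    have := congrArg Fin.val h
    simp at this
  rw [Fintype.sum_eq_add k.castSucc k.succ hne]
  · have e1 : |x - ((k.castSucc : Fin (m + 1)) : ℕ)| = x - (k : ℕ) := by
      rw [Fin.val_castSucc, abs_of_nonneg (by linarith)]
    have e2 : |x - ((k.succ : Fin (m + 1)) : ℕ)| = (k : ℕ) + 1 - x := by
      rw [Fin.val_succ, abs_of_nonpos (by push_cast; linarith)]
      push_cast
      ring
    rw [e1, e2, max_eq_right (by linarith), max_eq_right (by linarith)]
    ring
  · rintro j ⟨hj1, hj2⟩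
    have hj1' : (j : ℕ) ≠ k := fun h => hj1 (Fin.ext (by simpa using h))
    have hj2' : (j : ℕ) ≠ k + 1 := fun h => hj2 (Fin.ext (by simpa using h))
    rw [max_eq_left, mul_zero]
    rcases Nat.lt_or_ge (j : ℕ) k with h | h
    · have : ((j : ℕ) : ℝ) + 1 ≤ (k : ℕ) := by exact_mod_cast h
      have := le_abs_self (x - ((j : ℕ) : ℝ))
      linarith
    · have h2 : (k : ℕ) + 2 ≤ (j : ℕ) := by omega
      have : ((k : ℕ) : ℝ) + 2 ≤ (j : ℕ) := by exact_mod_cast h2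
      have := neg_abs_le (x - ((j : ℕ) : ℝ))
      linarith

theorem linearInterp_mem {m : ℕ} (hm : 0 < m) (v : Fin (m + 1) → ℝ)
    (hv : ∀ k, v k ∈ Set.Icc (-1 : ℝ) 1) (s : unitInterval) :
    linearInterp v (m * (s : ℝ)) ∈ Set.Icc (-1 : ℝ) 1 := by
  have hmr : (0 : ℝ) < m := by exact_mod_cast hm
  have hx0 : 0 ≤ (m : ℝ) * s := mul_nonneg hmr.le s.2.1
  have hx1 : (m : ℝ) * s ≤ m := mul_le_of_le_one_right hmr.le s.2.2
  obtain ⟨k, hk0, hk1⟩ : ∃ k : Fin m, ((k : ℕ) : ℝ) ≤ m * s ∧ (m : ℝ) * s ≤ (k : ℕ) + 1 := by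
    rcases hx1.lt_or_eq with h | h
    · exact ⟨⟨⌊(m : ℝ) * s⌋₊, (Nat.floor_lt hx0).2 h⟩, Nat.floor_le hx0,
        (Nat.lt_floor_add_one _).le⟩
    · have e : ((m - 1 : ℕ) : ℝ) = m - 1 := by
        rw [Nat.cast_sub hm, Nat.cast_one]
      refine ⟨⟨m - 1, by omega⟩, ?_, ?_⟩ <;> simp only [e] <;> linarith
  rw [linearInterp_eq v k hk0 hk1]
  obtain ⟨ha, hb⟩ := hv k.castSucc
  obtain ⟨hc, hd⟩ := hv k.succ
  constructor <;> nlinarith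

namespace PermutationProcess

variable {n : ℕ} (σ : PermutationProcess n)

/-- The rescaled position `2 σ_t(i) / n - 1` of a particle at the discrete time `t`. -/
noncomputable def position (i : Fin n) (t : Fin (σ.length + 1)) : ℝ :=
  2 * (((σ.perm t i : ℕ) : ℝ) + 1) / n - 1

theorem position_mem (i : Fin n) (t : Fin (σ.length + 1)) :
    σ.position i t ∈ Set.Icc (-1 : ℝ) 1 := by
  have hn : (0 : ℝ) < n := by exact_mod_cast i.pos
  have h : (((σ.perm t i : ℕ) : ℝ) + 1) ≤ n := by exact_mod_cast (σ.perm t i).2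
  have h0 : (0 : ℝ) ≤ ((σ.perm t i : ℕ) : ℝ) := Nat.cast_nonneg _
  unfold position
  constructor
  · have : 0 ≤ 2 * (((σ.perm t i : ℕ) : ℝ) + 1) / n := by positivity
    linarith
  · have : 2 * (((σ.perm t i : ℕ) : ℝ) + 1) / n ≤ 2 := by
      rw [div_le_iff₀ hn]
      linarith
    linarith

/-- The trajectory of particle `i`: its value at time `t / t_n` is `2 σ_t(i) / n - 1`, and it is
linear between these times. -/
noncomputable def trajectory (i : Fin n) : PathSpace where
  toFun s := ⟨linearInterp (σ.position i) (σ.length * (s : ℝ)),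
    linearInterp_mem σ.length_pos _ (σ.position_mem i) s⟩
  continuous_toFun := by
    unfold linearInterp
    fun_prop

end PermutationProcess

/-- The Borel σ-algebra of the path space. -/
instance PathSpace.instMeasurableSpace : MeasurableSpace PathSpace := borel PathSpace

instance PathSpace.instBorelSpace : BorelSpace PathSpace := ⟨rfl⟩

/-- The trajectory process `(1/n) ∑_i δ_{T_i}`, as a Borel measure on the path space; for `n ≥ 1`
it is a probability measure. -/
noncomputable def PermutationProcess.trajectoryMeasure {n : ℕ} (σ : PermutationProcess n) :
    Measure PathSpace :=
  (n : ENNReal)⁻¹ • ∑ i : Fin n, Measure.dirac (σ.trajectory i)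

/-- A `[-1,1]`-valued stochastic process indexed by `[0,1]`, with continuous sample paths:
every `X(t)` is a random variable. -/
def IsContinuousProcess {Ω : Type*} [MeasurableSpace Ω] (X : Ω → PathSpace) : Prop :=
  ∀ t : unitInterval, Measurable fun ω => X ω t

/-- A permuton process: a continuous `[-1,1]`-valued process with `X(t) ∼ Uniform[-1,1]` for
every `t`. -/
structure IsPermutonProcess {Ω : Type*} [MeasurableSpace Ω] (P : Measure Ω)
    (X : Ω → PathSpace) : Prop where
  isContinuousProcess : IsContinuousProcess X
  uniform : ∀ t : unitInterval,
    pdf.IsUniform (fun ω => (X ω t : ℝ)) (Set.Icc (-1 : ℝ) 1) P volume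

/-- The permutation processes `σ^n` converge to `X`: their trajectory processes converge weakly
to the law of `X`, that is, `E F(X^n) → E F(X)` for every bounded and uniformly continuous `F`. -/
def ConvergesTo {Ω : Type*} [MeasurableSpace Ω] (σ : ∀ n : ℕ, PermutationProcess n)
    (P : Measure Ω) (X : Ω → PathSpace) : Prop :=
  ∀ F : PathSpace → ℝ, UniformContinuous F → (∃ M : ℝ, ∀ f, |F f| ≤ M) →
    Tendsto (fun n => ∫ f, F f ∂(σ n).trajectoryMeasure) atTop (𝓝 (∫ ω, F (X ω) ∂P))

/-! Both directions compare averages over particles, and the main tool is the modulus of continuity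
`osc δ`. It is bounded and Lipschitz on the path space, hence itself an admissible test function for
weak convergence, and its mean under a fixed law vanishes as δ → 0. This takes the place of a
tightness argument.

Suppose the processes converge. At a discrete time the positions are a rearrangement of n equispaced
points, so the mean of a continuous f over them is a Riemann sum for the uniform law. Any t lies
within 1/t_n of a discrete time, and the error is controlled by the averaged modulus
(`ConvergesTo.integral_apply_eq`).

Conversely, the strong law yields a sequence of paths whose empirical measures converge to the law
of X (`exists_seq_tendsto_empiricalMeasure`). Since each marginal is uniform, replacing the values
of the first n paths at a fixed time by rescaled ranks moves all of them by little
(`eventually_abs_rankPerm_sub_le`). Ranks along a time grid whose mesh shrinks slowly with n form a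
permutation process, started at the identity by labelling particles by their initial rank. Its
trajectories differ from the paths by at most the rank error plus the modulus at the mesh. -/

/-! ### The modulus of continuity as a functional on paths. -/

namespace PathSpace

/-- The second coordinate of a pair of times, clamped to within `δ` of the first. -/
noncomputable def clampNear (δ : ℝ) : C(unitInterval × unitInterval, unitInterval) where
  toFun p := Set.projIcc (0 : ℝ) 1 zero_le_one (max ((p.1 : ℝ) - δ) (min ((p.1 : ℝ) + δ) p.2))
  continuous_toFun := by fun_prop

theorem dist_clampNear_le {δ : ℝ} (hδ : 0 ≤ δ) (p : unitInterval × unitInterval) :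
    dist p.1 (clampNear δ p) ≤ δ := by
  have h : |(p.1 : ℝ) - max ((p.1 : ℝ) - δ) (min ((p.1 : ℝ) + δ) p.2)| ≤ δ := by
    rw [abs_le]
    constructor
    · have := max_le (a := (p.1 : ℝ) - δ) (b := min ((p.1 : ℝ) + δ) p.2) (c := p.1 + δ)
        (by linarith) (min_le_left _ _)
      linarith
    · linarith [le_max_left ((p.1 : ℝ) - δ) (min ((p.1 : ℝ) + δ) p.2)]
  calc dist p.1 (clampNear δ p)
      = |((Set.projIcc (0 : ℝ) 1 zero_le_one p.1 : ℝ)) - Set.projIcc (0 : ℝ) 1 zero_le_one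
          (max ((p.1 : ℝ) - δ) (min ((p.1 : ℝ) + δ) p.2))| := by
        rw [Set.projIcc_val]; rfl
    _ ≤ _ := Set.abs_projIcc_sub_projIcc zero_le_one
    _ ≤ δ := h

theorem clampNear_eq {δ : ℝ} {s t : unitInterval} (h : dist s t ≤ δ) :
    clampNear δ (s, t) = t := by
  have h' : |(s : ℝ) - t| ≤ δ := h
  rw [abs_le] at h'
  change Set.projIcc (0 : ℝ) 1 zero_le_one (max ((s : ℝ) - δ) (min ((s : ℝ) + δ) t)) = t
  rw [min_eq_right (by linarith), max_eq_right (by linarith), Set.projIcc_val]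

/-- The modulus of continuity of a path at scale `δ`. -/
noncomputable def osc (δ : ℝ) (f : PathSpace) : ℝ :=
  dist (f.comp (⟨Prod.fst, continuous_fst⟩ : C(unitInterval × unitInterval, unitInterval)))
    (f.comp (clampNear δ))

theorem osc_nonneg (δ : ℝ) (f : PathSpace) : 0 ≤ osc δ f := dist_nonneg

theorem dist_le_two (x y : Set.Icc (-1 : ℝ) 1) : dist x y ≤ 2 := by
  have := Real.dist_le_of_mem_Icc x.2 y.2
  rw [Subtype.dist_eq]
  linarith

theorem osc_le_two (δ : ℝ) (f : PathSpace) : osc δ f ≤ 2 :=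
  (ContinuousMap.dist_le zero_le_two).2 fun _ => dist_le_two _ _

theorem dist_apply_le_osc {δ : ℝ} (f : PathSpace) {s t : unitInterval} (h : dist s t ≤ δ) :
    dist (f s) (f t) ≤ osc δ f := by
  have := ContinuousMap.dist_apply_le_dist (f := f.comp
    (⟨Prod.fst, continuous_fst⟩ : C(unitInterval × unitInterval, unitInterval)))
    (g := f.comp (clampNear δ)) (s, t)
  unfold osc
  simpa [clampNear_eq h] using this

theorem osc_le {δ C : ℝ} (hδ : 0 ≤ δ) (hC : 0 ≤ C) (f : PathSpace)
    (h : ∀ s t : unitInterval, dist s t ≤ δ → dist (f s) (f t) ≤ C) : osc δ f ≤ C :=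
  (ContinuousMap.dist_le hC).2 fun p => h _ _ (dist_clampNear_le hδ p)

theorem osc_mono {δ δ' : ℝ} (hδ : 0 ≤ δ) (h : δ ≤ δ') (f : PathSpace) : osc δ f ≤ osc δ' f :=
  osc_le hδ (osc_nonneg _ _) f fun _ _ hst => dist_apply_le_osc f (hst.trans h)

theorem dist_comp_le {X Y : Type*} [TopologicalSpace X] [CompactSpace X] [TopologicalSpace Y]
    [CompactSpace Y] {Z : Type*} [MetricSpace Z] (f g : C(Y, Z)) (c : C(X, Y)) :
    dist (f.comp c) (g.comp c) ≤ dist f g :=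
  (ContinuousMap.dist_le dist_nonneg).2 fun x => ContinuousMap.dist_apply_le_dist (f := f) (g := g) (c x)

/-- Clamping writes `osc δ f` as a distance between two compositions of `f` with fixed maps; each
composition is 1-Lipschitz in `f`, whence the factor 2. -/
theorem abs_osc_sub_osc_le (δ : ℝ) (f g : PathSpace) : |osc δ f - osc δ g| ≤ 2 * dist f g := by
  have := dist_dist_dist_le
    (f.comp (⟨Prod.fst, continuous_fst⟩ : C(unitInterval × unitInterval, unitInterval)))
    (f.comp (clampNear δ))
    (g.comp (⟨Prod.fst, continuous_fst⟩ : C(unitInterval × unitInterval, unitInterval)))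
    (g.comp (clampNear δ))
  have h1 := dist_comp_le f g
    (⟨Prod.fst, continuous_fst⟩ : C(unitInterval × unitInterval, unitInterval))
  have h2 := dist_comp_le f g (clampNear δ)
  rw [Real.dist_eq] at this
  unfold osc
  linarith

theorem uniformContinuous_osc (δ : ℝ) : UniformContinuous (osc δ) :=
  (LipschitzWith.of_dist_le_mul (K := 2) fun f g => by
    simpa [Real.dist_eq] using abs_osc_sub_osc_le δ f g).uniformContinuous

theorem tendsto_osc (f : PathSpace) :
    Tendsto (fun m : ℕ => osc (1 / ((m : ℝ) + 1)) f) atTop (𝓝 0) := by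
  rw [Metric.tendsto_atTop]
  intro ε hε
  obtain ⟨δ, hδ, h⟩ := Metric.uniformContinuous_iff.1
    (CompactSpace.uniformContinuous_of_continuous f.continuous) (ε / 2) (half_pos hε)
  obtain ⟨N, hN⟩ := exists_nat_one_div_lt hδ
  refine ⟨N, fun m hm => ?_⟩
  have hm' : 1 / ((m : ℝ) + 1) ≤ 1 / ((N : ℝ) + 1) := by gcongr
  rw [Real.dist_eq, sub_zero, abs_of_nonneg (osc_nonneg _ _)]
  refine lt_of_le_of_lt (osc_le (by positivity) (half_pos hε).le f fun s t hst => ?_)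
    (half_lt_self hε)
  exact (h (hst.trans_lt (hm'.trans_lt hN))).le

end PathSpace

/-- Nearby points use uniform continuity, distant ones the bound `M`. The estimate is affine in the
distance, so it can be averaged over particles without splitting off exceptional ones. -/
theorem UniformContinuous.exists_abs_sub_le {E : Type*} [PseudoMetricSpace E] {F : E → ℝ}
    (hF : UniformContinuous F) {M : ℝ} (hM : ∀ x, |F x| ≤ M) {ε : ℝ} (hε : 0 < ε) :
    ∃ C, 0 ≤ C ∧ ∀ x y, |F x - F y| ≤ ε + C * dist x y := by
  obtain ⟨δ, hδ, h⟩ := Metric.uniformContinuous_iff.1 hF ε hε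
  refine ⟨|2 * M / δ|, abs_nonneg _, fun x y => ?_⟩
  rcases lt_or_ge (dist x y) δ with hd | hd
  · have := h hd
    rw [Real.dist_eq] at this
    have : 0 ≤ |2 * M / δ| * dist x y := by positivity
    linarith
  · have hM0 : 0 ≤ M := (abs_nonneg _).trans (hM x)
    have h1 : |F x - F y| ≤ 2 * M := by
      have := abs_sub (F x) (F y)
      linarith [hM x, hM y]
    have h2 : 2 * M ≤ |2 * M / δ| * dist x y := by
      rw [abs_of_nonneg (by positivity)]
      calc 2 * M = 2 * M / δ * δ := by field_simp
        _ ≤ _ := by gcongr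
    linarith

/-! ### Trajectories and the time grid. -/

namespace PermutationProcess

/-- The `k`-th of the `m + 1` equidistant times in `[0, 1]`. -/
noncomputable def gridTime {m : ℕ} (k : Fin (m + 1)) : unitInterval :=
  ⟨(k : ℕ) / m, div_nonneg (Nat.cast_nonneg _) (Nat.cast_nonneg _),
    div_le_one_of_le₀ (by exact_mod_cast Nat.lt_succ_iff.1 k.2) (Nat.cast_nonneg _)⟩

theorem exists_grid_interval {m : ℕ} (hm : 0 < m) (s : unitInterval) :
    ∃ k : Fin m, ((k : ℕ) : ℝ) ≤ m * s ∧ (m : ℝ) * s ≤ (k : ℕ) + 1 := by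
  have hmr : (0 : ℝ) < m := by exact_mod_cast hm
  have hx0 : 0 ≤ (m : ℝ) * s := mul_nonneg hmr.le s.2.1
  have hx1 : (m : ℝ) * s ≤ m := mul_le_of_le_one_right hmr.le s.2.2
  rcases hx1.lt_or_eq with h | h
  · exact ⟨⟨⌊(m : ℝ) * s⌋₊, (Nat.floor_lt hx0).2 h⟩, Nat.floor_le hx0,
      (Nat.lt_floor_add_one _).le⟩
  · have e : ((m - 1 : ℕ) : ℝ) = m - 1 := by
      rw [Nat.cast_sub hm, Nat.cast_one]
    refine ⟨⟨m - 1, by omega⟩, ?_, ?_⟩ <;> simp only [e] <;> linarith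

theorem dist_gridTime_castSucc_le {m : ℕ} (hm : 0 < m) {s : unitInterval} {k : Fin m}
    (h0 : ((k : ℕ) : ℝ) ≤ m * s) (h1 : (m : ℝ) * s ≤ (k : ℕ) + 1) :
    dist (gridTime k.castSucc) s ≤ 1 / m := by
  have hmr : (0 : ℝ) < m := by exact_mod_cast hm
  change |((k : ℕ) : ℝ) / m - s| ≤ 1 / m
  rw [abs_le, ← sub_nonneg, ← sub_nonneg (b := _ - _)]
  constructor
  · rw [show ((k : ℕ) : ℝ) / m - s - -(1 / m) = ((k : ℕ) + 1 - m * s) / m by field_simp; ring]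
    exact div_nonneg (by linarith) hmr.le
  · rw [show 1 / (m : ℝ) - (((k : ℕ) : ℝ) / m - s) = (1 + m * s - (k : ℕ)) / m by field_simp; ring]
    exact div_nonneg (by linarith) hmr.le

theorem dist_gridTime_succ_le {m : ℕ} (hm : 0 < m) {s : unitInterval} {k : Fin m}
    (h0 : ((k : ℕ) : ℝ) ≤ m * s) (h1 : (m : ℝ) * s ≤ (k : ℕ) + 1) :
    dist (gridTime k.succ) s ≤ 1 / m := by
  have hmr : (0 : ℝ) < m := by exact_mod_cast hm
  change |((k + 1 : ℕ) : ℝ) / m - s| ≤ 1 / m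
  push_cast
  rw [abs_le, ← sub_nonneg, ← sub_nonneg (b := _ - _)]
  constructor
  · rw [show (((k : ℕ) : ℝ) + 1) / m - s - -(1 / m) = ((k : ℕ) + 2 - m * s) / m by field_simp; ring]
    exact div_nonneg (by linarith) hmr.le
  · rw [show 1 / (m : ℝ) - ((((k : ℕ) : ℝ) + 1) / m - s) = (m * s - (k : ℕ)) / m by
      field_simp; ring]
    exact div_nonneg (by linarith) hmr.le

variable {n : ℕ} (σ : PermutationProcess n)

theorem trajectory_gridTime_castSucc (i : Fin n) (k : Fin σ.length) :
    (σ.trajectory i (gridTime k.castSucc) : ℝ) = σ.position i k.castSucc := by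
  have hmr : (0 : ℝ) < σ.length := by exact_mod_cast σ.length_pos
  change linearInterp (σ.position i) (σ.length * (((k : ℕ) : ℝ) / σ.length)) = _
  rw [mul_div_cancel₀ _ hmr.ne', linearInterp_eq _ k le_rfl (by linarith)]
  ring

/-- Between grid times the trajectory is a convex combination of two positions, each within `ε` of a
value of `f` at most one mesh away in time. -/
theorem dist_trajectory_le {i : Fin n} {f : PathSpace} {ε : ℝ}
    (h : ∀ k, |σ.position i k - f (gridTime k)| ≤ ε) :
    dist (σ.trajectory i) f ≤ ε + PathSpace.osc (1 / σ.length) f := by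
  have hε : 0 ≤ ε := (abs_nonneg _).trans (h 0)
  have ho := PathSpace.osc_nonneg (1 / σ.length) f
  refine (ContinuousMap.dist_le (by linarith)).2 fun s => ?_
  obtain ⟨k, h0, h1⟩ := exists_grid_interval σ.length_pos s
  change |linearInterp (σ.position i) (σ.length * (s : ℝ)) - f s| ≤ _
  rw [linearInterp_eq _ k h0 h1]
  have a1 := abs_le.1 (h k.castSucc)
  have a2 := abs_le.1 (h k.succ)
  have b1 : |(f (gridTime k.castSucc) : ℝ) - f s| ≤ PathSpace.osc (1 / σ.length) f :=
    PathSpace.dist_apply_le_osc f (dist_gridTime_castSucc_le σ.length_pos h0 h1)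
  have b2 : |(f (gridTime k.succ) : ℝ) - f s| ≤ PathSpace.osc (1 / σ.length) f :=
    PathSpace.dist_apply_le_osc f (dist_gridTime_succ_le σ.length_pos h0 h1)
  rw [abs_le] at b1 b2 ⊢
  constructor <;> nlinarith

theorem integral_trajectoryMeasure {F : PathSpace → ℝ} (hF : Continuous F) :
    ∫ f, F f ∂σ.trajectoryMeasure = (∑ i : Fin n, F (σ.trajectory i)) / n := by
  unfold trajectoryMeasure
  rw [integral_smul_measure, integral_finsetSum_measure]
  · simp [integral_dirac' _ _ hF.stronglyMeasurable, div_eq_inv_mul]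
  · intro i _
    exact integrable_dirac' hF.stronglyMeasurable (by simp)

end PermutationProcess

/-! ### Borel measurability and the expected modulus. -/

/-- A path-valued map with measurable evaluations is Borel measurable. -/
theorem IsContinuousProcess.measurable {Ω : Type*} [MeasurableSpace Ω] {X : Ω → PathSpace}
    (hX : IsContinuousProcess X) : Measurable X := by
  have hball : ∀ f r, MeasurableSet (X ⁻¹' Metric.closedBall f r) := by
    intro f r
    rcases lt_or_ge r 0 with hr | hr
    · simp [Metric.closedBall_eq_empty.2 hr]
    -- By continuity, a uniform bound needs checking only at countably many dense times.
    · have e : X ⁻¹' Metric.closedBall f r =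
          ⋂ k : ℕ, {ω | dist (X ω (TopologicalSpace.denseSeq unitInterval k))
            (f (TopologicalSpace.denseSeq unitInterval k)) ≤ r} := by
        ext ω
        simp only [Set.mem_preimage, Metric.mem_closedBall, ContinuousMap.dist_le hr,
          Set.mem_iInter, Set.mem_ofPred_eq]
        refine ⟨fun h k => h _, fun h t => ?_⟩
        refine (TopologicalSpace.denseRange_denseSeq unitInterval).induction_on
          (p := fun t => dist (X ω t) (f t) ≤ r) t ?_ h
        exact isClosed_le (by fun_prop) continuous_const
      rw [e]
      exact MeasurableSet.iInter fun k =>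
        measurableSet_le ((hX _).dist measurable_const) measurable_const
  refine measurable_of_isOpen fun U hU => ?_
  have : Nonempty PathSpace := ⟨ContinuousMap.const _ ⟨1, by norm_num⟩⟩
  obtain ⟨d, hd⟩ := TopologicalSpace.exists_dense_seq PathSpace
  -- The path space is separable, so countably many closed balls inside `U` exhaust it.
  have e : U = ⋃ (k : ℕ) (m : ℕ) (_ : Metric.closedBall (d k) (1 / ((m : ℝ) + 1)) ⊆ U),
      Metric.closedBall (d k) (1 / ((m : ℝ) + 1)) := by
    apply Set.Subset.antisymm
    · intro f hf
      obtain ⟨ε, hε, hb⟩ := Metric.isOpen_iff.1 hU f hf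
      obtain ⟨m, hm⟩ := exists_nat_one_div_lt (half_pos hε)
      obtain ⟨k, hk⟩ := hd.exists_dist_lt f (ε := 1 / ((m : ℝ) + 1)) (by positivity)
      simp only [Set.mem_iUnion]
      refine ⟨k, m, fun g hg => hb ?_, hk.le⟩
      rw [Metric.mem_closedBall] at hg
      rw [Metric.mem_ball]
      have := dist_triangle g (d k) f
      rw [dist_comm (d k) f] at this
      linarith
    · intro f hf
      simp only [Set.mem_iUnion] at hf
      obtain ⟨k, m, h, hf⟩ := hf
      exact h hf
  rw [e]
  simp only [Set.preimage_iUnion]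
  exact MeasurableSet.iUnion fun k => MeasurableSet.iUnion fun m => MeasurableSet.iUnion fun _ =>
    hball _ _

theorem tendsto_integral_osc {Ω : Type*} [MeasurableSpace Ω] (P : Measure Ω) [IsFiniteMeasure P]
    {X : Ω → PathSpace} (hX : Measurable X) :
    Tendsto (fun m : ℕ => ∫ ω, PathSpace.osc (1 / ((m : ℝ) + 1)) (X ω) ∂P) atTop (𝓝 0) := by
  have := tendsto_integral_of_dominated_convergence (μ := P)
    (F := fun (m : ℕ) ω => PathSpace.osc (1 / ((m : ℝ) + 1)) (X ω)) (f := fun _ => 0) (fun _ => 2)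
    (fun m => ((PathSpace.uniformContinuous_osc _).continuous.measurable.comp
      hX).aestronglyMeasurable) (integrable_const _)
    (fun m => ae_of_all _ fun ω => by
      rw [Real.norm_eq_abs, abs_of_nonneg (PathSpace.osc_nonneg _ _)]
      exact PathSpace.osc_le_two _ _)
    (ae_of_all _ fun ω => PathSpace.tendsto_osc (X ω))
  simpa using this

/-! ### Limits of permutation processes have uniform marginals. -/

/-- Averages over equidistant points converge to the mean value. -/
theorem tendsto_average_grid {f : ℝ → ℝ} (hf : Continuous f) :
    Tendsto (fun n : ℕ => (∑ k ∈ Finset.range n, f (2 * ((k : ℝ) + 1) / n - 1)) / n) atTop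
      (𝓝 ((∫ x in (-1 : ℝ)..1, f x) / 2)) := by
  rw [Metric.tendsto_atTop]
  intro ε hε
  obtain ⟨δ, hδ, h⟩ := Metric.uniformContinuousOn_iff.1
    ((isCompact_Icc (a := (-1 : ℝ)) (b := 1)).uniformContinuousOn_of_continuous hf.continuousOn)
    (ε / 2) (half_pos hε)
  obtain ⟨N, hN⟩ := exists_nat_gt (2 / δ)
  refine ⟨N + 1, fun n hn => ?_⟩
  have hn0 : (0 : ℝ) < n := by exact_mod_cast (Nat.succ_pos N).trans_le hn
  have hNn : (N : ℝ) < n := by exact_mod_cast hn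
  have hstep : 2 / (n : ℝ) < δ := by
    rw [div_lt_iff₀ hn0]
    rw [div_lt_iff₀ hδ] at hN
    nlinarith
  -- Nodes of the partition of [-1, 1] into `n` cells; the average samples right endpoints, `a 1` to
  -- `a n`.
  set a : ℕ → ℝ := fun k => 2 * (k : ℝ) / n - 1 with ha
  have hsucc : ∀ k, a (k + 1) = a k + 2 / n := fun k => by simp only [ha]; push_cast; ring
  have hint : ∫ x in (-1 : ℝ)..1, f x = ∑ k ∈ Finset.range n, ∫ x in a k..a (k + 1), f x := by
    rw [intervalIntegral.sum_integral_adjacent_intervals fun k _ => hf.intervalIntegrable _ _]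
    congr 1
    · simp [ha]
    · simp only [ha]; field_simp; norm_num
  have hterm : ∀ k ∈ Finset.range n,
      |f (a (k + 1)) * (2 / n) - ∫ x in a k..a (k + 1), f x| ≤ ε / 2 * (2 / n) := by
    intro k hk
    have hkn : (k : ℝ) + 1 ≤ n := by exact_mod_cast Finset.mem_range.1 hk
    have hpos : 0 < 2 / (n : ℝ) := by positivity
    have e1 : f (a (k + 1)) * (2 / n) = ∫ x in a k..a (k + 1), f (a (k + 1)) := by
      rw [intervalIntegral.integral_const, hsucc, smul_eq_mul]; ring
    have lo : -1 ≤ a k := by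
      have : 0 ≤ 2 * (k : ℝ) / n := by positivity
      simp only [ha]; linarith
    have hi : a (k + 1) ≤ 1 := by
      have : 2 * ((k : ℝ) + 1) / n ≤ 2 := by rw [div_le_iff₀ hn0]; linarith
      simp only [ha]; push_cast; linarith
    rw [e1, ← intervalIntegral.integral_sub (by simp) (hf.intervalIntegrable _ _)]
    have := intervalIntegral.norm_integral_le_of_norm_le_const (a := a k) (b := a (k + 1))
      (f := fun x => f (a (k + 1)) - f x) (C := ε / 2) fun x hx => by
        rw [Set.uIoc_of_le (by rw [hsucc]; linarith)] at hx
        have h1 := hx.1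
        have h2 := hx.2
        refine (h (a (k + 1)) ⟨by rw [hsucc]; linarith, hi⟩ x ⟨by linarith, by linarith⟩ ?_).le
        rw [Real.dist_eq, abs_of_nonneg (by linarith)]
        have := hsucc k
        linarith
    rwa [Real.norm_eq_abs, hsucc, add_sub_cancel_left, abs_of_pos hpos, ← hsucc] at this
  have hsum := (Finset.abs_sum_le_sum_abs _ _).trans (Finset.sum_le_sum hterm)
  rw [Finset.sum_sub_distrib, ← hint, ← Finset.sum_mul, Finset.sum_const, Finset.card_range,
    nsmul_eq_mul] at hsum
  have e2 : (n : ℝ) * (ε / 2 * (2 / n)) = ε := by field_simp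
  rw [e2] at hsum
  have e3 : (∑ k ∈ Finset.range n, f (2 * ((k : ℝ) + 1) / n - 1)) / n
      - (∫ x in (-1 : ℝ)..1, f x) / 2 =
      ((∑ k ∈ Finset.range n, f (a (k + 1))) * (2 / n) - ∫ x in (-1 : ℝ)..1, f x) / 2 := by
    simp only [ha]; push_cast; ring
  rw [Real.dist_eq, e3, abs_div, abs_two]
  linarith

theorem PermutationProcess.sum_position {n : ℕ} (σ : PermutationProcess n) (f : ℝ → ℝ)
    (t : Fin (σ.length + 1)) :
    ∑ i : Fin n, f (σ.position i t) = ∑ k ∈ Finset.range n, f (2 * ((k : ℝ) + 1) / n - 1) := by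
  unfold position
  rw [Equiv.sum_comp (σ.perm t) fun j : Fin n => f (2 * (((j : ℕ) : ℝ) + 1) / n - 1),
    Fin.sum_univ_eq_sum_range fun k => f (2 * ((k : ℝ) + 1) / n - 1)]

/-- The one-dimensional marginals of a limit of permutation processes have uniform means of test
functions. -/
theorem ConvergesTo.integral_apply_eq {Ω : Type*} [MeasurableSpace Ω] {P : Measure Ω}
    [IsFiniteMeasure P] {X : Ω → PathSpace} (hX : Measurable X)
    {σ : ∀ n : ℕ, PermutationProcess n}
    (hlen : Tendsto (fun n => (σ n).length) atTop atTop) (h : ConvergesTo σ P X)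
    (t : unitInterval) {f : ℝ → ℝ} (hf : Continuous f) :
    ∫ ω, f (X ω t) ∂P = (∫ x in (-1 : ℝ)..1, f x) / 2 := by
  set g : Set.Icc (-1 : ℝ) 1 → ℝ := fun y => f y with hg
  have hgc : Continuous g := by fun_prop
  have hgu : UniformContinuous g := CompactSpace.uniformContinuous_of_continuous hgc
  obtain ⟨M, hM⟩ : ∃ M, ∀ y, |g y| ≤ M := by
    obtain ⟨M, hM⟩ := (isCompact_range hgc).isBounded.exists_norm_le
    exact ⟨M, fun y => hM _ ⟨y, rfl⟩⟩
  have heval : UniformContinuous fun φ : PathSpace => φ t :=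
    (LipschitzWith.of_dist_le_mul (K := 1) fun φ ψ => by
      simpa using ContinuousMap.dist_apply_le_dist (f := φ) (g := ψ) t).uniformContinuous
  have hF : UniformContinuous fun φ : PathSpace => g (φ t) := hgu.comp heval
  have l1 := h _ hF ⟨M, fun φ => hM _⟩
  simp only [PermutationProcess.integral_trajectoryMeasure _ hF.continuous] at l1
  have l2 := tendsto_average_grid hf
  refine tendsto_nhds_unique l1 ?_
  suffices hd : Tendsto (fun n : ℕ => (∑ i : Fin n, g ((σ n).trajectory i t)) / n -
      (∑ k ∈ Finset.range n, f (2 * ((k : ℝ) + 1) / n - 1)) / n) atTop (𝓝 0) by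
    simpa using hd.add l2
  rw [Metric.tendsto_atTop]
  intro ε hε
  obtain ⟨C, hC, hgC⟩ := hgu.exists_abs_sub_le hM (half_pos hε)
  have hosc := (tendsto_integral_osc P hX).const_mul C
  rw [mul_zero] at hosc
  -- The scale `m` is fixed by the limit law before `n` grows; weak convergence tested on the
  -- modulus then carries the bound over to the trajectories.
  obtain ⟨m, hm⟩ := ((tendsto_order.1 hosc).2 (ε / 2) (half_pos hε)).exists
  have l3 := (h _ (PathSpace.uniformContinuous_osc (1 / ((m : ℝ) + 1))) ⟨2, fun φ => by
    rw [abs_of_nonneg (PathSpace.osc_nonneg _ _)]; exact PathSpace.osc_le_two _ _⟩).const_mul C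
  simp only [PermutationProcess.integral_trajectoryMeasure _
    (PathSpace.uniformContinuous_osc _).continuous] at l3
  obtain ⟨N, hN⟩ := eventually_atTop.1 (((tendsto_order.1 l3).2 (ε / 2) hm).and
    ((hlen.eventually_ge_atTop (m + 1)).and (eventually_gt_atTop 0)))
  refine ⟨N, fun n hn => ?_⟩
  obtain ⟨h1, h2, h3⟩ := hN n hn
  have hn0 : (0 : ℝ) < n := by exact_mod_cast h3
  obtain ⟨k, hk0, hk1⟩ := PermutationProcess.exists_grid_interval (σ n).length_pos t
  have hdist : dist (PermutationProcess.gridTime k.castSucc) t ≤ 1 / ((m : ℝ) + 1) := by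
    refine (PermutationProcess.dist_gridTime_castSucc_le (σ n).length_pos hk0 hk1).trans ?_
    gcongr
    exact_mod_cast h2
  rw [← (σ n).sum_position f k.castSucc, ← sub_div, ← Finset.sum_sub_distrib, Real.dist_eq,
    sub_zero, abs_div, abs_of_pos hn0, div_lt_iff₀ hn0]
  rw [← mul_div_assoc, div_lt_iff₀ hn0] at h1
  calc |∑ i : Fin n, (g ((σ n).trajectory i t) - f ((σ n).position i k.castSucc))|
      ≤ ∑ i : Fin n, |g ((σ n).trajectory i t) - f ((σ n).position i k.castSucc)| :=
        Finset.abs_sum_le_sum_abs _ _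
    _ ≤ ∑ i : Fin n, (ε / 2 + C * PathSpace.osc (1 / ((m : ℝ) + 1)) ((σ n).trajectory i)) := by
        refine Finset.sum_le_sum fun i _ => ?_
        rw [← (σ n).trajectory_gridTime_castSucc i k]
        refine (hgC _ _).trans ?_
        gcongr
        rw [dist_comm]
        exact PathSpace.dist_apply_le_osc _ hdist
    _ < ε * n := by
        rw [Finset.sum_add_distrib, ← Finset.mul_sum, Finset.sum_const, Finset.card_univ,
          Fintype.card_fin, nsmul_eq_mul]
        linarith

theorem ConvergesTo.isPermutonProcess {Ω : Type*} [MeasurableSpace Ω] {P : Measure Ω}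
    [IsFiniteMeasure P] {X : Ω → PathSpace} (hX : IsContinuousProcess X)
    {σ : ∀ n : ℕ, PermutationProcess n}
    (hlen : Tendsto (fun n => (σ n).length) atTop atTop) (h : ConvergesTo σ P X) :
    IsPermutonProcess P X := by
  refine ⟨hX, fun t => ?_⟩
  have hm : Measurable fun ω => (X ω t : ℝ) := measurable_subtype_coe.comp (hX t)
  refine ext_of_forall_integral_eq_of_IsFiniteMeasure fun f => ?_
  rw [integral_map hm.aemeasurable f.continuous.aestronglyMeasurable,
    h.integral_apply_eq hX.measurable hlen t f.continuous, ProbabilityTheory.cond,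
    integral_smul_measure, intervalIntegral.integral_of_le (by norm_num),
    integral_Icc_eq_integral_Ioc]
  norm_num [Real.volume_Icc, div_eq_inv_mul]

/-! ### Approximating a law by empirical measures. -/

section Empirical

variable {E : Type*} [MeasurableSpace E]

/-- The empirical measure of the first `n + 1` terms of a sequence. -/
noncomputable def empiricalMeasure (x : ℕ → E) (n : ℕ) : ProbabilityMeasure E :=
  ⟨((n + 1 : ℕ) : ENNReal)⁻¹ • ∑ i ∈ Finset.range (n + 1), Measure.dirac (x i), ⟨by
    simp only [Measure.smul_apply, Measure.finsetSum_apply, measure_univ, smul_eq_mul,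
      Finset.sum_const, Finset.card_range, nsmul_eq_mul, mul_one]
    exact ENNReal.inv_mul_cancel (by simp) (ENNReal.natCast_ne_top _)⟩⟩

theorem integral_empiricalMeasure (x : ℕ → E) (n : ℕ) {f : E → ℝ} (hf : StronglyMeasurable f) :
    ∫ y, f y ∂(empiricalMeasure x n : Measure E) =
      (∑ i ∈ Finset.range (n + 1), f (x i)) / ((n + 1 : ℕ) : ℝ) := by
  change ∫ y, f y ∂(((n + 1 : ℕ) : ENNReal)⁻¹ • ∑ i ∈ Finset.range (n + 1), Measure.dirac (x i)) = _
  rw [integral_smul_measure, integral_finsetSum_measure]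
  · simp only [integral_dirac' _ _ hf, div_eq_inv_mul, ENNReal.toReal_inv, ENNReal.toReal_natCast,
      smul_eq_mul]
  · intro i _
    exact integrable_dirac' hf (by simp)

theorem empiricalMeasure_real (x : ℕ → E) (n : ℕ) {s : Set E} (hs : MeasurableSet s) :
    (empiricalMeasure x n : Measure E).real s =
      (∑ i ∈ Finset.range (n + 1), s.indicator (1 : E → ℝ) (x i)) / ((n + 1 : ℕ) : ℝ) := by
  rw [← integral_indicator_one hs,
    integral_empiricalMeasure x n (stronglyMeasurable_one.indicator hs)]

/-- An i.i.d. sample works almost surely: the strong law holds for each set, and countability allows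
one null set for all of them. -/
theorem exists_seq_tendsto_frequency (μ : Measure E) [IsProbabilityMeasure μ] {S : Set (Set E)}
    (hS : S.Countable) (hmeas : ∀ s ∈ S, MeasurableSet s) :
    ∃ x : ℕ → E, ∀ s ∈ S, Tendsto (fun n : ℕ =>
      (∑ i ∈ Finset.range n, s.indicator (1 : E → ℝ) (x i)) / n) atTop (𝓝 (μ.real s)) := by
  have hae : ∀ s ∈ S, ∀ᵐ x ∂(Measure.infinitePi fun _ : ℕ => μ), Tendsto (fun n : ℕ =>
      (∑ i ∈ Finset.range n, s.indicator (1 : E → ℝ) (x i)) / n) atTop (𝓝 (μ.real s)) := by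
    intro s hs
    have hm : Measurable (s.indicator (1 : E → ℝ)) := measurable_one.indicator (hmeas s hs)
    have hmap : ∀ i : ℕ, (Measure.infinitePi fun _ : ℕ => μ).map (fun x => x i) = μ :=
      fun i => Measure.infinitePi_map_eval (fun _ : ℕ => μ) i
    have hlaw : ∀ i : ℕ, (Measure.infinitePi fun _ : ℕ => μ).map
        (fun x => s.indicator (1 : E → ℝ) (x i)) = μ.map (s.indicator (1 : E → ℝ)) := by
      intro i
      conv_rhs => rw [← hmap i]
      rw [Measure.map_map hm (measurable_pi_apply i)]
      rfl
    have hindep := ProbabilityTheory.iIndepFun_infinitePi (P := fun _ : ℕ => μ)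
      (X := fun _ : ℕ => s.indicator (1 : E → ℝ)) fun _ => hm
    have hint : Integrable (fun x : ℕ → E => s.indicator (1 : E → ℝ) (x 0))
        (Measure.infinitePi fun _ : ℕ => μ) := by
      refine Integrable.of_bound (hm.comp (measurable_pi_apply 0)).aestronglyMeasurable 1
        (ae_of_all _ fun x => ?_)
      by_cases h : x 0 ∈ s <;> simp [h]
    have key := ProbabilityTheory.strong_law_ae_real
      (fun (i : ℕ) (x : ℕ → E) => s.indicator (1 : E → ℝ) (x i)) hint
      (fun i j hij => hindep.indepFun hij)
      (fun i => ⟨(hm.comp (measurable_pi_apply i)).aemeasurable,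
        (hm.comp (measurable_pi_apply 0)).aemeasurable, by rw [hlaw, hlaw]⟩)
    have e : ∫ x : ℕ → E, s.indicator (1 : E → ℝ) (x 0) ∂(Measure.infinitePi fun _ : ℕ => μ) =
        μ.real s := by
      rw [← integral_indicator_one (hmeas s hs)]
      conv_rhs => rw [← hmap 0]
      rw [integral_map (measurable_pi_apply 0).aemeasurable hm.aestronglyMeasurable]
    rwa [e] at key
  exact ((ae_ball_iff hS).2 hae).exists

/-- A second countable space has a countable π-system of open sets that is a basis. -/
theorem exists_countable_isPiSystem_basis (E : Type*) [TopologicalSpace E]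
    [SecondCountableTopology E] :
    ∃ S : Set (Set E), S.Countable ∧ IsPiSystem S ∧ (∀ s ∈ S, IsOpen s) ∧
      ∀ u : Set E, IsOpen u → ∀ x ∈ u, ∃ s ∈ S, s ∈ 𝓝 x ∧ s ⊆ u := by
  set B := TopologicalSpace.countableBasis E
  have hB := TopologicalSpace.isBasis_countableBasis E
  refine ⟨Set.sInter '' {T | T.Finite ∧ T ⊆ B},
    (Set.countable_ofPred_finite_subset (TopologicalSpace.countable_countableBasis E)).image _,
    ?_, ?_, ?_⟩
  · rintro _ ⟨T, ⟨hT, hTB⟩, rfl⟩ _ ⟨U, ⟨hU, hUB⟩, rfl⟩ _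
    exact ⟨T ∪ U, ⟨hT.union hU, Set.union_subset hTB hUB⟩, Set.sInter_union _ _⟩
  · rintro _ ⟨T, ⟨hT, hTB⟩, rfl⟩
    exact hT.isOpen_sInter fun t ht => hB.isOpen (hTB ht)
  · intro u hu x hx
    obtain ⟨v, hv, hxv, hvu⟩ := hB.exists_subset_of_mem_open hx hu
    exact ⟨v, ⟨{v}, ⟨Set.finite_singleton v, by simpa using hv⟩, by simp⟩,
      (hB.isOpen hv).mem_nhds hxv, hvu⟩

/-- Every probability measure on a second countable space is the weak limit of the empirical
measures of some sequence. -/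
theorem exists_seq_tendsto_empiricalMeasure [TopologicalSpace E] [SecondCountableTopology E]
    [OpensMeasurableSpace E] (μ : ProbabilityMeasure E) :
    ∃ x : ℕ → E, Tendsto (empiricalMeasure x) atTop (𝓝 μ) := by
  obtain ⟨S, hSc, hSpi, hSo, hSb⟩ := exists_countable_isPiSystem_basis E
  obtain ⟨x, hx⟩ := exists_seq_tendsto_frequency (μ : Measure E) hSc
    fun s hs => (hSo s hs).measurableSet
  refine ⟨x, hSpi.tendsto_probabilityMeasure_of_tendsto_of_mem
    (fun s hs => (hSo s hs).measurableSet) hSb fun s hs => ?_⟩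
  -- `empiricalMeasure x n` averages `n + 1` terms, hence the shift.
  have h := (tendsto_add_atTop_iff_nat 1).2 (hx s hs)
  have e : ∀ n, (∑ i ∈ Finset.range (n + 1), s.indicator (1 : E → ℝ) (x i)) / ((n + 1 : ℕ) : ℝ) =
      (empiricalMeasure x n s : ℝ) := fun n =>
    (empiricalMeasure_real x n (hSo s hs).measurableSet).symm
  simp only [e] at h
  exact NNReal.tendsto_coe.1 h

theorem tendsto_average_of_tendsto_empiricalMeasure [TopologicalSpace E] [SecondCountableTopology E]
    [OpensMeasurableSpace E] [TopologicalSpace.PseudoMetrizableSpace E]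
    {x : ℕ → E} {μ : ProbabilityMeasure E}
    (hx : Tendsto (empiricalMeasure x) atTop (𝓝 μ)) {f : E → ℝ} (hf : Continuous f) {M : ℝ}
    (hM : ∀ y, |f y| ≤ M) :
    Tendsto (fun n : ℕ => (∑ i ∈ Finset.range n, f (x i)) / n) atTop
      (𝓝 (∫ y, f y ∂(μ : Measure E))) := by
  rw [← tendsto_add_atTop_iff_nat 1]
  have := ProbabilityMeasure.tendsto_iff_forall_integral_tendsto.1 hx
    (BoundedContinuousFunction.ofNormedAddCommGroup f hf M hM)
  simpa only [BoundedContinuousFunction.coe_ofNormedAddCommGroup,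
    integral_empiricalMeasure _ _ hf.stronglyMeasurable] using this

open Classical in
theorem tendsto_frequency_of_tendsto_empiricalMeasure [TopologicalSpace E] [OpensMeasurableSpace E]
    [HasOuterApproxClosed E] {x : ℕ → E} {μ : ProbabilityMeasure E}
    (hx : Tendsto (empiricalMeasure x) atTop (𝓝 μ)) {s : Set E} (hs : MeasurableSet s)
    (hμ : (μ : Measure E) (frontier s) = 0) :
    Tendsto (fun n : ℕ => (((Finset.range n).filter fun i => x i ∈ s).card : ℝ) / n) atTop
      (𝓝 ((μ : Measure E).real s)) := by
  rw [← tendsto_add_atTop_iff_nat 1]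
  have h := ProbabilityMeasure.tendsto_measure_of_null_frontier_of_tendsto' hx hμ
  have h' := (ENNReal.tendsto_toReal (measure_ne_top (μ : Measure E) s)).comp h
  refine h'.congr fun n => ?_
  refine (empiricalMeasure_real x n hs).trans ?_
  simp [Set.indicator_apply]

end Empirical

/-! ### Ranks and empirical distribution functions. -/

/-- The rank of each entry of a tuple of reals, ties being broken by the index. -/
noncomputable def rankPerm {n : ℕ} (v : Fin n → ℝ) : Equiv.Perm (Fin n) := (Tuple.sort v).symm

theorem rankPerm_lt {n : ℕ} {v : Fin n → ℝ} {i j : Fin n} (h : v i < v j) :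
    rankPerm v i < rankPerm v j := by
  by_contra hle
  have := Tuple.monotone_sort v (not_lt.1 hle)
  simp only [Function.comp_apply, rankPerm, Equiv.apply_symm_apply] at this
  exact absurd h (not_lt.2 this)

theorem Fin.card_filter_univ_eq_card_filter_range (n : ℕ) (p : ℕ → Prop) [DecidablePred p] :
    (Finset.univ.filter fun i : Fin n => p i).card = ((Finset.range n).filter p).card := by
  simp only [Finset.card_filter, Fin.sum_univ_eq_sum_range fun i => if p i then 1 else 0]

/-- Strictly smaller entries have strictly smaller ranks. With `rankPerm_lt_card_le` this brackets a
rank however ties are broken. -/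
theorem card_lt_le_rankPerm {n : ℕ} (v : Fin n → ℝ) (i : Fin n) :
    (Finset.univ.filter fun j => v j < v i).card ≤ (rankPerm v i : ℕ) := by
  rw [← Fin.card_Iio, ← Finset.card_map (rankPerm v).toEmbedding]
  refine Finset.card_le_card fun k hk => ?_
  simp only [Finset.mem_map, Finset.mem_filter, Finset.mem_univ, true_and] at hk
  obtain ⟨j, hj, rfl⟩ := hk
  exact Finset.mem_Iio.2 (rankPerm_lt hj)

theorem rankPerm_lt_card_le {n : ℕ} (v : Fin n → ℝ) (i : Fin n) :
    (rankPerm v i : ℕ) + 1 ≤ (Finset.univ.filter fun j => v j ≤ v i).card := by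
  rw [← Fin.card_Iic, ← Finset.card_map (rankPerm v).symm.toEmbedding]
  refine Finset.card_le_card fun k hk => ?_
  simp only [Finset.mem_map, Finset.mem_Iic] at hk
  obtain ⟨j, hj, rfl⟩ := hk
  simp only [Finset.mem_filter, Finset.mem_univ, true_and]
  by_contra hlt
  have := rankPerm_lt (not_le.1 hlt)
  simp only [Equiv.coe_toEmbedding, Equiv.apply_symm_apply] at this
  exact absurd hj (not_le.2 this)

/-- If the empirical distribution function of `v` is close to that of the uniform distribution on
`[-1, 1]` along a grid, then every entry is close to its rescaled rank. -/
theorem abs_rankPerm_sub_le {n : ℕ} {v : Fin n → ℝ} (hv : ∀ i, v i ∈ Set.Icc (-1 : ℝ) 1) {K : ℕ}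
    (hK : 0 < K)
    (hlt : ∀ j ≤ K, (j : ℝ) / K - 1 / K ≤
      ((Finset.univ.filter fun i => v i < 2 * ((j : ℝ) / K) - 1).card : ℝ) / n)
    (hle : ∀ j ≤ K, ((Finset.univ.filter fun i => v i ≤ 2 * ((j : ℝ) / K) - 1).card : ℝ) / n ≤
      (j : ℝ) / K + 1 / K) (i : Fin n) :
    |2 * ((rankPerm v i : ℕ) + 1 : ℝ) / n - 1 - v i| ≤ 4 / K := by
  have hn : (0 : ℝ) < n := by exact_mod_cast i.pos
  have hK' : (0 : ℝ) < K := by exact_mod_cast hK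
  obtain ⟨h1, h2⟩ := hv i
  have hy0 : 0 ≤ (v i + 1) / 2 * K := mul_nonneg (by linarith) hK'.le
  -- The grid cell containing `v i`. One cell width plus one discrepancy `1 / K`, doubled by the
  -- rescaling to [-1, 1], gives `4 / K`.
  set j := ⌊(v i + 1) / 2 * K⌋₊ with hj
  have hj1 : (j : ℝ) ≤ (v i + 1) / 2 * K := Nat.floor_le hy0
  have hj2 : (v i + 1) / 2 * K < j + 1 := Nat.lt_floor_add_one _
  have hjK : j ≤ K := by
    have : (j : ℝ) ≤ K := hj1.trans (by nlinarith)
    exact_mod_cast this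
  have hlo : (j : ℝ) / K ≤ (v i + 1) / 2 := by rwa [div_le_iff₀ hK']
  have hhi : (v i + 1) / 2 ≤ (j : ℝ) / K + 1 / K := by
    rw [← add_div, le_div_iff₀ hK']; exact hj2.le
  -- The minimum keeps the upper grid point in range when `v i = 1`, where `j = K`.
  have hhi' : (v i + 1) / 2 ≤ ((min (j + 1) K : ℕ) : ℝ) / K := by
    rcases min_cases (j + 1) K with ⟨e, _⟩ | ⟨e, _⟩ <;> rw [e]
    · push_cast; rwa [add_div (j : ℝ)]
    · rw [div_self hK'.ne']; linarith
  have hmin : ((min (j + 1) K : ℕ) : ℝ) / K ≤ (j : ℝ) / K + 1 / K := by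
    rw [← add_div]
    gcongr
    exact_mod_cast min_le_left _ _
  have lower : ((Finset.univ.filter fun l => v l < 2 * ((j : ℝ) / K) - 1).card : ℝ) ≤
      (rankPerm v i : ℕ) := by
    refine Nat.cast_le.2 (le_trans (Finset.card_le_card fun l hl => ?_) (card_lt_le_rankPerm v i))
    simp only [Finset.mem_filter, Finset.mem_univ, true_and] at hl ⊢
    linarith
  have upper : ((rankPerm v i : ℕ) : ℝ) + 1 ≤ ((Finset.univ.filter fun l =>
      v l ≤ 2 * (((min (j + 1) K : ℕ) : ℝ) / K) - 1).card : ℝ) := by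
    have : (rankPerm v i : ℕ) + 1 ≤ (Finset.univ.filter fun l =>
        v l ≤ 2 * (((min (j + 1) K : ℕ) : ℝ) / K) - 1).card := by
      refine le_trans (rankPerm_lt_card_le v i) (Finset.card_le_card fun l hl => ?_)
      simp only [Finset.mem_filter, Finset.mem_univ, true_and] at hl ⊢
      linarith
    exact_mod_cast this
  have l1 := hlt j hjK
  have l2 : ((Finset.univ.filter fun l => v l < 2 * ((j : ℝ) / K) - 1).card : ℝ) / n ≤
      ((rankPerm v i : ℕ) + 1 : ℝ) / n := by
    gcongr
    linarith
  have u1 := hle (min (j + 1) K) (min_le_right _ _)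
  have u2 := div_le_div_of_nonneg_right upper hn.le
  have e4 : (4 : ℝ) / K = 4 * (1 / K) := by ring
  rw [mul_div_assoc, e4, abs_le]
  constructor <;> linarith

/-! ### Diagonal choice of the grid and the rank process. -/

/-- A property that holds eventually for each `m` holds along some `m → ∞`. -/
theorem exists_tendsto_atTop_of_forall_eventually {p : ℕ → ℕ → Prop}
    (h : ∀ m, ∀ᶠ n in atTop, p m n) :
    ∃ m : ℕ → ℕ, Tendsto m atTop atTop ∧ ∀ᶠ n in atTop, p (m n) n := by
  classical
  -- The search defaults to 0 when nothing is found, so `p 0 n` is needed, and it holds eventually.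
  refine ⟨fun n => Nat.findGreatest (fun m => p m n) n, ?_, ?_⟩
  · rw [tendsto_atTop]
    intro b
    filter_upwards [h b, eventually_ge_atTop b] with n hn hb
    exact Nat.le_findGreatest hb hn
  · filter_upwards [h 0] with n hn
    exact Nat.findGreatest_spec (P := fun m => p m n) (Nat.zero_le n) hn

/-- The permutation process that records the ranks of the first `n` of a sequence of paths at
`m + 2` equidistant times, particles being labelled by their rank at time `0`. -/
noncomputable def rankProcess (x : ℕ → PathSpace) (n m : ℕ) : PermutationProcess n where
  length := m + 1
  length_pos := m.succ_pos
  perm k := (rankPerm fun i : Fin n =>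
      (x i (PermutationProcess.gridTime (0 : Fin (m + 1 + 1))) : ℝ)).symm.trans
    (rankPerm fun i : Fin n => (x i (PermutationProcess.gridTime k) : ℝ))
  perm_zero := Equiv.symm_trans_self _

/-- Undoes the labelling by initial rank, so that the `i`-th summand follows the path `x i`. -/
theorem sum_rankProcess_trajectory (x : ℕ → PathSpace) (n m : ℕ) (F : PathSpace → ℝ) :
    ∑ i : Fin n, F ((rankProcess x n m).trajectory i) =
      ∑ i : Fin n, F ((rankProcess x n m).trajectory
        (rankPerm (fun i : Fin n =>
          (x i (PermutationProcess.gridTime (0 : Fin (m + 1 + 1))) : ℝ)) i)) :=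
  (Equiv.sum_comp _ fun i => F ((rankProcess x n m).trajectory i)).symm

theorem rankProcess_position (x : ℕ → PathSpace) (n m : ℕ) (i : Fin n) (k : Fin (m + 1 + 1)) :
    (rankProcess x n m).position
        (rankPerm (fun i : Fin n =>
          (x i (PermutationProcess.gridTime (0 : Fin (m + 1 + 1))) : ℝ)) i) k =
      2 * ((rankPerm (fun i : Fin n =>
        (x i (PermutationProcess.gridTime k) : ℝ)) i : ℕ) + 1 : ℝ) / n - 1 := by
  simp [PermutationProcess.position, rankProcess]

/-! ### Ranks approximate values when the marginal is uniform. -/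

section Uniform

variable {μ : ProbabilityMeasure PathSpace} {s : unitInterval}

/-- Absence of atoms makes the frontiers of half-line events null, as convergence of frequencies
requires. -/
theorem measure_apply_eq_of_uniform
    (hμ : (μ : Measure PathSpace).map (fun f => (f s : ℝ)) =
      ProbabilityTheory.cond volume (Set.Icc (-1 : ℝ) 1))
    (r : ℝ) :
    (μ : Measure PathSpace) {f | (f s : ℝ) = r} = 0 := by
  have hm : Measurable fun f : PathSpace => (f s : ℝ) := Continuous.measurable (by fun_prop)
  have e : {f : PathSpace | (f s : ℝ) = r} = (fun f : PathSpace => (f s : ℝ)) ⁻¹' {r} := rfl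
  rw [e, ← Measure.map_apply hm (measurableSet_singleton r), hμ]
  exact ProbabilityTheory.cond_absolutelyContinuous Real.volume_singleton

theorem measureReal_apply_le_of_uniform
    (hμ : (μ : Measure PathSpace).map (fun f => (f s : ℝ)) =
      ProbabilityTheory.cond volume (Set.Icc (-1 : ℝ) 1))
    {r : ℝ} (h0 : -1 ≤ r) (h1 : r ≤ 1) :
    (μ : Measure PathSpace).real {f | (f s : ℝ) ≤ r} = (r + 1) / 2 := by
  have hm : Measurable fun f : PathSpace => (f s : ℝ) := Continuous.measurable (by fun_prop)
  have e : {f : PathSpace | (f s : ℝ) ≤ r} = (fun f : PathSpace => (f s : ℝ)) ⁻¹' Set.Iic r := rfl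
  have e2 : Set.Icc (-1 : ℝ) 1 ∩ Set.Iic r = Set.Icc (-1) r := by
    ext y; simp only [Set.mem_inter_iff, Set.mem_Icc, Set.mem_Iic]; constructor
    · rintro ⟨⟨a, b⟩, c⟩; exact ⟨a, c⟩
    · rintro ⟨a, c⟩; exact ⟨⟨a, c.trans h1⟩, c⟩
  rw [measureReal_def, e, ← Measure.map_apply hm measurableSet_Iic, hμ,
    ProbabilityTheory.cond_apply measurableSet_Icc, e2, Real.volume_Icc, Real.volume_Icc,
    ENNReal.toReal_mul, ENNReal.toReal_inv, ENNReal.toReal_ofReal (by norm_num),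
    ENNReal.toReal_ofReal (by linarith)]
  ring

theorem measureReal_apply_lt_of_uniform
    (hμ : (μ : Measure PathSpace).map (fun f => (f s : ℝ)) =
      ProbabilityTheory.cond volume (Set.Icc (-1 : ℝ) 1))
    {r : ℝ} (h0 : -1 ≤ r) (h1 : r ≤ 1) :
    (μ : Measure PathSpace).real {f | (f s : ℝ) < r} = (r + 1) / 2 := by
  rw [← measureReal_apply_le_of_uniform hμ h0 h1]
  refine measureReal_congr (Filter.eventuallyEq_set.2 ?_)
  filter_upwards [measure_eq_zero_iff_ae_notMem.1 (measure_apply_eq_of_uniform hμ r)] with f hf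
  exact ⟨le_of_lt, fun h => lt_of_le_of_ne h hf⟩

/-- Uniformity in `i` comes from monotonicity of distribution functions: only finitely many
thresholds, depending on `ε` alone, have to be controlled. -/
theorem eventually_abs_rankPerm_sub_le
    (hμ : (μ : Measure PathSpace).map (fun f => (f s : ℝ)) =
      ProbabilityTheory.cond volume (Set.Icc (-1 : ℝ) 1))
    {x : ℕ → PathSpace}
    (hx : Tendsto (empiricalMeasure x) atTop (𝓝 μ)) {ε : ℝ} (hε : 0 < ε) :
    ∀ᶠ n : ℕ in atTop, ∀ i : Fin n,
      |2 * ((rankPerm (fun i : Fin n => (x i s : ℝ)) i : ℕ) + 1 : ℝ) / n - 1 - x i s| ≤ ε := by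
  classical
  have hc : Continuous fun f : PathSpace => (f s : ℝ) := by fun_prop
  obtain ⟨K, hK⟩ := exists_nat_gt (4 / ε)
  have hK' : (0 : ℝ) < K := (by positivity : (0 : ℝ) < 4 / ε).trans hK
  have hKn : 0 < K := by exact_mod_cast hK'
  have hKi : 0 < 1 / (K : ℝ) := by positivity
  have hKε : 4 / (K : ℝ) ≤ ε := by
    rw [div_le_iff₀ hK']; rw [div_lt_iff₀ hε] at hK; linarith
  have hr : ∀ j ≤ K, -1 ≤ 2 * ((j : ℝ) / K) - 1 ∧ 2 * ((j : ℝ) / K) - 1 ≤ 1 := by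
    intro j hj
    have a : 0 ≤ (j : ℝ) / K := by positivity
    have b : (j : ℝ) / K ≤ 1 := div_le_one_of_le₀ (by exact_mod_cast hj) hK'.le
    constructor <;> linarith
  have hlt : ∀ j ∈ Set.Iic K, ∀ᶠ n : ℕ in atTop, (j : ℝ) / K - 1 / K <
      (((Finset.range n).filter fun i =>
        x i ∈ {f : PathSpace | (f s : ℝ) < 2 * ((j : ℝ) / K) - 1}).card : ℝ) / n := by
    intro j hj
    have l := tendsto_frequency_of_tendsto_empiricalMeasure hx
      (s := {f : PathSpace | (f s : ℝ) < 2 * ((j : ℝ) / K) - 1})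
      (isOpen_lt hc continuous_const).measurableSet
      (measure_mono_null (frontier_lt_subset_eq hc continuous_const)
        (measure_apply_eq_of_uniform hμ _))
    rw [measureReal_apply_lt_of_uniform hμ (hr j hj).1 (hr j hj).2] at l
    convert! (tendsto_order.1 l).1 ((j : ℝ) / K - 1 / K) (by linarith)
  have hle : ∀ j ∈ Set.Iic K, ∀ᶠ n : ℕ in atTop,
      (((Finset.range n).filter fun i =>
        x i ∈ {f : PathSpace | (f s : ℝ) ≤ 2 * ((j : ℝ) / K) - 1}).card : ℝ) / n <
      (j : ℝ) / K + 1 / K := by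
    intro j hj
    have l := tendsto_frequency_of_tendsto_empiricalMeasure hx
      (s := {f : PathSpace | (f s : ℝ) ≤ 2 * ((j : ℝ) / K) - 1})
      (isClosed_le hc continuous_const).measurableSet
      (measure_mono_null (frontier_le_subset_eq hc continuous_const)
        (measure_apply_eq_of_uniform hμ _))
    rw [measureReal_apply_le_of_uniform hμ (hr j hj).1 (hr j hj).2] at l
    convert! (tendsto_order.1 l).2 ((j : ℝ) / K + 1 / K) (by linarith)
  filter_upwards [(eventually_all_finite (Set.finite_Iic K)).2 hlt,
    (eventually_all_finite (Set.finite_Iic K)).2 hle] with n h1 h2 i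
  refine (abs_rankPerm_sub_le (v := fun i : Fin n => (x i s : ℝ)) (fun i => (x i s).2) hKn
    (fun j hj => ?_) (fun j hj => ?_) i).trans hKε
  · rw [Fin.card_filter_univ_eq_card_filter_range n
      fun i => (x i s : ℝ) < 2 * ((j : ℝ) / K) - 1]
    exact (h1 j hj).le
  · rw [Fin.card_filter_univ_eq_card_filter_range n
      fun i => (x i s : ℝ) ≤ 2 * ((j : ℝ) / K) - 1]
    exact (h2 j hj).le

end Uniform

/-! ### Realising a permuton process as a limit. -/

theorem exists_permutationProcess_tendsto {μ : ProbabilityMeasure PathSpace}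
    (hμ : ∀ s : unitInterval, (μ : Measure PathSpace).map (fun f => (f s : ℝ)) =
      ProbabilityTheory.cond volume (Set.Icc (-1 : ℝ) 1)) :
    ∃ σ : ∀ n : ℕ, PermutationProcess n,
      Tendsto (fun n => (σ n).length) atTop atTop ∧
        ConvergesTo σ (μ : Measure PathSpace) id := by
  obtain ⟨x, hx⟩ := exists_seq_tendsto_empiricalMeasure μ
  -- The property covers all `m + 2` grid times at once, so `m n` grows slowly enough for ranks and
  -- values to agree within `1 / (m n + 1)` on the whole grid.
  obtain ⟨m, hm, hclose⟩ := exists_tendsto_atTop_of_forall_eventually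
    (p := fun m n => ∀ (k : Fin (m + 1 + 1)) (i : Fin n),
      |2 * ((rankPerm (fun i : Fin n => (x i (PermutationProcess.gridTime k) : ℝ)) i : ℕ) + 1 : ℝ)
        / n - 1 - x i (PermutationProcess.gridTime k)| ≤ 1 / ((m : ℝ) + 1))
    (fun m => eventually_all.2 fun k => eventually_abs_rankPerm_sub_le
      (hμ (PermutationProcess.gridTime k)) hx (by positivity))
  refine ⟨fun n => rankProcess x n (m n), tendsto_atTop_mono (fun n => Nat.le_succ _) hm, ?_⟩
  rintro F hF ⟨M, hM⟩
  have hA := tendsto_average_of_tendsto_empiricalMeasure hx hF.continuous hM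
  simp only [PermutationProcess.integral_trajectoryMeasure _ hF.continuous, id]
  suffices hd : Tendsto (fun n : ℕ =>
      (∑ i : Fin n, F ((rankProcess x n (m n)).trajectory i)) / n -
        (∑ i ∈ Finset.range n, F (x i)) / n) atTop (𝓝 0) by
    simpa using hd.add hA
  rw [Metric.tendsto_atTop]
  intro ε hε
  obtain ⟨C, hC, hFC⟩ := hF.exists_abs_sub_le hM (half_pos hε)
  have hosc := (((tendsto_integral_osc (μ : Measure PathSpace) measurable_id).add
    (tendsto_one_div_add_atTop_nhds_zero_nat (𝕜 := ℝ))).const_mul C)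
  rw [add_zero, mul_zero] at hosc
  obtain ⟨q, hq⟩ := ((tendsto_order.1 hosc).2 (ε / 2) (half_pos hε)).exists
  have hB := ((tendsto_average_of_tendsto_empiricalMeasure hx
    (PathSpace.uniformContinuous_osc (1 / ((q : ℝ) + 1))).continuous (M := 2) fun φ => by
      rw [abs_of_nonneg (PathSpace.osc_nonneg _ _)]; exact PathSpace.osc_le_two _ _).add_const
        (1 / ((q : ℝ) + 1))).const_mul C
  obtain ⟨N, hN⟩ := eventually_atTop.1 (((tendsto_order.1 hB).2 (ε / 2) hq).and
    ((hm.eventually_ge_atTop q).and ((eventually_gt_atTop 0).and hclose)))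
  refine ⟨N, fun n hn => ?_⟩
  obtain ⟨h1, h2, h3, h4⟩ := hN n hn
  have hn0 : (0 : ℝ) < n := by exact_mod_cast h3
  have hmq : 1 / ((m n : ℝ) + 1) ≤ 1 / ((q : ℝ) + 1) := by gcongr
  have hdist : ∀ i : Fin n, dist ((rankProcess x n (m n)).trajectory
        (rankPerm (fun i : Fin n =>
          (x i (PermutationProcess.gridTime (0 : Fin (m n + 1 + 1))) : ℝ)) i)) (x i) ≤
      1 / ((q : ℝ) + 1) + PathSpace.osc (1 / ((q : ℝ) + 1)) (x i) := by
    intro i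
    -- Both the rank error and the mesh are `1 / (m n + 1)`, at most the fixed scale `1 / (q + 1)`.
    refine ((rankProcess x n (m n)).dist_trajectory_le (ε := 1 / ((m n : ℝ) + 1))
      fun k => ?_).trans (add_le_add hmq (PathSpace.osc_mono (by positivity) ?_ _))
    · have := h4 k i
      rw [← rankProcess_position x n (m n) i k] at this
      exact this
    · have : ((rankProcess x n (m n)).length : ℝ) = (m n : ℝ) + 1 := by simp [rankProcess]
      rwa [this]
  rw [sum_rankProcess_trajectory, ← Fin.sum_univ_eq_sum_range fun i => F (x i), ← sub_div,
    ← Finset.sum_sub_distrib, Real.dist_eq, sub_zero, abs_div, abs_of_pos hn0, div_lt_iff₀ hn0]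
  rw [← Fin.sum_univ_eq_sum_range fun i => PathSpace.osc (1 / ((q : ℝ) + 1)) (x i)] at h1
  have h1' := mul_lt_mul_of_pos_right h1 hn0
  have e : C * ((∑ i : Fin n, PathSpace.osc (1 / ((q : ℝ) + 1)) (x i)) / n + 1 / ((q : ℝ) + 1)) * n
      = ∑ i : Fin n, C * (1 / ((q : ℝ) + 1) + PathSpace.osc (1 / ((q : ℝ) + 1)) (x i)) := by
    rw [← Finset.mul_sum, Finset.sum_add_distrib, Finset.sum_const, Finset.card_univ,
      Fintype.card_fin, nsmul_eq_mul]
    field_simp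
    ring
  rw [e] at h1'
  refine (Finset.abs_sum_le_sum_abs _ _).trans_lt ?_
  refine (Finset.sum_le_sum fun i _ => (hFC _ _).trans
    (add_le_add_right (mul_le_mul_of_nonneg_left (hdist i) hC) _)).trans_lt ?_
  rw [Finset.sum_add_distrib, Finset.sum_const, Finset.card_univ, Fintype.card_fin, nsmul_eq_mul]
  linarith

theorem IsPermutonProcess.exists_convergesTo {Ω : Type*} [MeasurableSpace Ω] {P : Measure Ω}
    [IsProbabilityMeasure P] {X : Ω → PathSpace} (hperm : IsPermutonProcess P X) :
    ∃ σ : ∀ n : ℕ, PermutationProcess n,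
      Tendsto (fun n => (σ n).length) atTop atTop ∧ ConvergesTo σ P X := by
  have hX := hperm.isContinuousProcess.measurable
  obtain ⟨σ, hlen, hσ⟩ := exists_permutationProcess_tendsto
    (μ := ⟨P.map X, Measure.isProbabilityMeasure_map hX.aemeasurable⟩) fun s => by
      have hm : Measurable fun f : PathSpace => (f s : ℝ) := Continuous.measurable (by fun_prop)
      change (P.map X).map _ = _
      rw [Measure.map_map hm hX]
      exact hperm.uniform s
  refine ⟨σ, hlen, fun F hF hM => ?_⟩
  have := hσ F hF hM
  simp only [ProbabilityMeasure.coe_mk, id] at this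
  rwa [integral_map hX.aemeasurable hF.continuous.aestronglyMeasurable] at this

theorem theorem1 {Ω : Type*} [MeasurableSpace Ω] (P : Measure Ω) [IsProbabilityMeasure P]
    (X : Ω → PathSpace) (hX : IsContinuousProcess X) :
    (∀ σ : ∀ n : ℕ, PermutationProcess n,
      Tendsto (fun n => (σ n).length) atTop atTop → ConvergesTo σ P X →
        IsPermutonProcess P X) ∧
    (IsPermutonProcess P X →
      ∃ σ : ∀ n : ℕ, PermutationProcess n,
        Tendsto (fun n => (σ n).length) atTop atTop ∧ ConvergesTo σ P X) :=
  ⟨fun _ hlen hconv => hconv.isPermutonProcess hX hlen, fun h => h.exists_convergesTo⟩
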